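/- Let $\mathcal{X}$ be a Polish space and let $\mathsf{G}$ be a real vector space of continuous functions $\mathsf{g}:\mathcal{X}\to\mathbb{R}$ that contains the constants and is such that for all $\mathsf{g}_1,\mathsf{g}_2\in\mathsf{G}$ there is $\mathsf{g}\in\mathsf{G}$ with $\mathsf{g}_1\vee\mathsf{g}_2\le\mathsf{g}$ pointwise. Let $\chi:\mathcal{X}\to[0,\infty]$ be a regularity modulus for $\mathsf{G}$, that is, a lower semicontinuous function such that the set $\{X\in\mathcal{X}:\chi(X)\le\mathsf{g}(X)\}$ is relatively compact for every $\mathsf{g}\in\mathsf{G}$. Let $\Phi:\mathsf{G}\to\mathbb{R}$ be a linear functional that is positive, i.e. $\Phi(\mathsf{g})\ge 0$ whenever $\mathsf{g}\in\mathsf{G}$ and $\mathsf{g}\ge 0$ pointwise. Then, for every real $r\ge 0$, the family $\mathfrak{M}$ of (the distributions of) all Borel random elements $\xi$ in $\mathcal{X}$ such that $$\mathbf{E}\,\mathsf{g}(\xi)=\Phi(\mathsf{g})\quad\text{for all }\mathsf{g}\in\mathsf{G}\ (\text{in particular } \mathsf{g}(\xi)\text{ is integrable}),\qquad \mathbf{E}\,\chi(\xi)\le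 r,$$ is compact in the topology of weak convergence of probability measures on $\mathcal{X}$. -/

import Mathlib

open MeasureTheory
open scoped NNReal ENNReal

/-- The vector space `G` of real functions on `X` contains the constants, and any two members
have a common majorant in `G`. -/
structure ConstantsAndMajorants {X : Type*} (G : Submodule ℝ (X → ℝ)) : Prop where
  const_mem : ∀ c : ℝ, (fun _ : X => c) ∈ G
  exists_majorant : ∀ g₁ ∈ G, ∀ g₂ ∈ G, ∃ g ∈ G, g₁ ⊔ g₂ ≤ g

/-- The set `{x | χ x ≤ g x}`. The comparison takes place in the extended reals, so a point with
`g x < 0` never belongs to it. -/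
def sublevelAgainst {X : Type*} (χ : X → ℝ≥0∞) (g : X → ℝ) : Set X :=
  {x | (χ x : EReal) ≤ (g x : EReal)}

/-- `χ : X → [0, ∞]` is a regularity modulus with respect to `G`: it is lower semicontinuous and
`{x | χ x ≤ g x}` is relatively compact for every `g ∈ G`. -/
structure IsRegularityModulus {X : Type*} [TopologicalSpace X]
    (G : Submodule ℝ (X → ℝ)) (χ : X → ℝ≥0∞) : Prop where
  lowerSemicontinuous : LowerSemicontinuous χ
  relativelyCompact : ∀ g ∈ G, IsCompact (closure (sublevelAgainst χ g))

/-- A linear functional on `G` is positive if it is nonnegative on the pointwise nonnegative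
members of `G`. -/
def IsPositiveFunctional {X : Type*} {G : Submodule ℝ (X → ℝ)} (Φ : G →ₗ[ℝ] ℝ) : Prop :=
  ∀ g : G, (∀ x, 0 ≤ (g : X → ℝ) x) → 0 ≤ Φ g

/-- The random element `ξ`, defined on a space with probability `P`, realises `Φ` on `G` with
`E χ(ξ) ≤ r`: it is Borel, every `g(ξ)` has a finite expectation, equal to `Φ g`, and
`E χ(ξ) ≤ r`. -/
structure RealisesWithBound {X Ω : Type*} [MeasurableSpace X] [MeasurableSpace Ω]
    {G : Submodule ℝ (X → ℝ)} (Φ : G →ₗ[ℝ] ℝ) (χ : X → ℝ≥0∞) (r : ℝ≥0)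
    (P : Measure Ω) (ξ : Ω → X) : Prop where
  measurable : Measurable ξ
  integrable : ∀ g : G, Integrable (fun ω => (g : X → ℝ) (ξ ω)) P
  expectation_eq : ∀ g : G, ∫ ω, (g : X → ℝ) (ξ ω) ∂P = Φ g
  expectation_modulus_le : ∫⁻ ω, χ (ξ ω) ∂P ≤ r

/-- The family of (the distributions of) all Borel random elements in `X` that realise `Φ` on `G`
with `E χ(ξ) ≤ r`. The probability spaces range over the universe of `X`, which contains the
canonical space `X` itself, so every possible distribution occurs. -/
def realisingFamily.{u} {X : Type u} [MeasurableSpace X]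
    {G : Submodule ℝ (X → ℝ)} (Φ : G →ₗ[ℝ] ℝ) (χ : X → ℝ≥0∞) (r : ℝ≥0) :
    Set (ProbabilityMeasure X) :=
  {μ | ∃ (Ω : Type u) (_ : MeasurableSpace Ω) (P : Measure Ω) (_ : IsProbabilityMeasure P)
      (ξ : Ω → X), RealisesWithBound Φ χ r P ξ ∧ P.map ξ = (μ : Measure X)}

section WeakConvergence

open Filter Set
open scoped Topology BoundedContinuousFunction

variable {X : Type*} [TopologicalSpace X] [MeasurableSpace X] [BorelSpace X]

/-! The bound `∫ χ ≤ r` alone cuts out a compact set of measures: it is closed because `χ` is lower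
semicontinuous, and tight by Markov's inequality, since constants lie in `G` and so the sets `{χ ≤
n}` are relatively compact; Prokhorov's theorem applies. On this set each `μ ↦ ∫ g` is continuous
although `g` may be unbounded (`IsRegularityModulus.exists_truncation`): with `|g| ≤ h ∈ G`, off the
relatively compact set `{χ ≤ h/ε}` one has `|g| ≤ h ≤ εχ`, so truncating `g` costs at most `εr` in
the integral. The equations `∫ g = Φ g` then define a closed subset. -/

/-- Portmanteau for bounded lower semicontinuous functions: the expectation is lower semicontinuous
along weakly convergent sequences. -/
lemma lintegral_min_le_liminf_of_tendsto [HasOuterApproxClosed X] {χ : X → ℝ≥0∞}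
    (hχ : LowerSemicontinuous χ) (N : ℝ≥0) {μs : ℕ → ProbabilityMeasure X}
    {μ : ProbabilityMeasure X} (hμ : Tendsto μs atTop (𝓝 μ)) :
    ∫⁻ x, min (χ x) N ∂(μ : Measure X)
      ≤ atTop.liminf fun n => ∫⁻ x, min (χ x) N ∂(μs n : Measure X) := by
  have htop : ∀ x, min (χ x) (N : ℝ≥0∞) ≠ ∞ := fun x =>
    ne_top_of_le_ne_top ENNReal.coe_ne_top (min_le_right _ _)
  have hopen : ∀ t : ℝ, 0 < t → IsOpen {x | t < (min (χ x) (N : ℝ≥0∞)).toReal} := by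
    intro t ht
    have hset : {x | t < (min (χ x) (N : ℝ≥0∞)).toReal}
        = {x | ENNReal.ofReal t < χ x} ∩ {_x | ENNReal.ofReal t < N} := by
      ext x
      simp [← ENNReal.ofReal_lt_iff_lt_toReal ht.le (htop x)]
    rw [hset]
    exact (hχ.isOpen_preimage (ENNReal.ofReal t)).inter isOpen_const
  have hlayer : ∀ ν : Measure X, ∫⁻ x, min (χ x) N ∂ν
      = ∫⁻ t in Ioi (0 : ℝ), ν {x | t < (min (χ x) (N : ℝ≥0∞)).toReal} := by
    intro ν
    rw [← lintegral_eq_lintegral_meas_lt ν (Eventually.of_forall fun x => ENNReal.toReal_nonneg)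
      ((hχ.measurable.min measurable_const).ennreal_toReal.aemeasurable)]
    exact lintegral_congr fun x => (ENNReal.ofReal_toReal (htop x)).symm
  simp_rw [hlayer]
  calc ∫⁻ t in Ioi (0 : ℝ), (μ : Measure X) {x | t < (min (χ x) (N : ℝ≥0∞)).toReal}
      ≤ ∫⁻ t in Ioi (0 : ℝ), atTop.liminf fun n =>
          (μs n : Measure X) {x | t < (min (χ x) (N : ℝ≥0∞)).toReal} :=
        setLIntegral_mono' measurableSet_Ioi fun t ht =>
          ProbabilityMeasure.le_liminf_measure_open_of_tendsto hμ (hopen t ht)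
    _ ≤ _ := lintegral_liminf_le fun n => Antitone.measurable fun s t hst =>
          measure_mono fun x hx => lt_of_le_of_lt hst hx

/-- By monotone convergence it suffices to bound the integrals of `min χ n`. -/
lemma isClosed_setOf_lintegral_le [PolishSpace X] {χ : X → ℝ≥0∞} (hχ : LowerSemicontinuous χ)
    (c : ℝ≥0∞) : IsClosed {μ : ProbabilityMeasure X | ∫⁻ x, χ x ∂(μ : Measure X) ≤ c} := by
  let := TopologicalSpace.upgradeIsCompletelyMetrizable X
  refine IsSeqClosed.isClosed fun μs μ hμs hμ => ?_
  have hsup : ∀ x, χ x = ⨆ n : ℕ, min (χ x) ((n : ℝ≥0) : ℝ≥0∞) := by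
    intro x
    have h := ENNReal.iSup_natCast
    simp only [ENNReal.coe_natCast]
    rw [← inf_iSup_eq, h, inf_top_eq]
  have hmono : Monotone fun (n : ℕ) (x : X) => min (χ x) ((n : ℝ≥0) : ℝ≥0∞) := by
    intro m n hmn x
    dsimp only
    gcongr
  simp only [mem_ofPred_eq]
  rw [lintegral_congr hsup, lintegral_iSup (fun n => hχ.measurable.min measurable_const) hmono]
  refine iSup_le fun n => (lintegral_min_le_liminf_of_tendsto hχ n hμ).trans ?_
  refine liminf_le_of_frequently_le' (Frequently.of_forall fun k => ?_)
  exact (lintegral_mono fun x => min_le_left _ _).trans (hμs k)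

/-- The truncation of a continuous function at the levels `-c` and `c`. -/
noncomputable def boundedTruncation {g : X → ℝ} (hg : Continuous g) (c : ℝ) (hc : 0 ≤ c) :
    X →ᵇ ℝ :=
  BoundedContinuousFunction.ofNormedAddCommGroup (fun x => max (-c) (min (g x) c))
    (by fun_prop) c fun x => abs_le.2 ⟨le_max_left _ _, max_le (by linarith) (min_le_right _ _)⟩

end WeakConvergence

section RegularityModulus

open Filter Set
open scoped Topology

variable {X : Type*} {G : Submodule ℝ (X → ℝ)} {χ : X → ℝ≥0∞}

lemma ConstantsAndMajorants.exists_abs_le (hG : ConstantsAndMajorants G) {g : X → ℝ}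
    (hg : g ∈ G) : ∃ h ∈ G, ∀ x, |g x| ≤ h x := by
  obtain ⟨h, hh, hle⟩ := hG.exists_majorant g hg (-g) (G.neg_mem hg)
  exact ⟨h, hh, fun x => hle x⟩

lemma ofReal_le_of_notMem_sublevelAgainst {g : X → ℝ} {x : X}
    (hx : x ∉ sublevelAgainst χ g) : ENNReal.ofReal (g x) ≤ χ x := by
  have h : (g x : EReal) < χ x := not_le.1 hx
  rw [← EReal.coe_ennreal_le_coe_ennreal_iff, EReal.coe_ennreal_ofReal]
  rcases max_choice (g x) 0 with h' | h' <;> rw [h']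
  · exact h.le
  · exact EReal.coe_ennreal_nonneg _

variable [TopologicalSpace X]

lemma IsRegularityModulus.exists_truncation (hχ : IsRegularityModulus G χ)
    (hG : ConstantsAndMajorants G) {g : X → ℝ} (hg : g ∈ G) (hgc : Continuous g) {ε : ℝ}
    (hε : 0 < ε) : ∃ (c : ℝ) (hc : 0 ≤ c),
      ∀ x, ‖g x - boundedTruncation hgc c hc x‖ₑ ≤ ENNReal.ofReal ε * χ x := by
  obtain ⟨h, hh, hle⟩ := hG.exists_abs_le hg
  -- The level `c` bounds `|g|` where `χ ≤ h/ε`, so truncation changes nothing there.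
  obtain ⟨c, hc⟩ := (hχ.relativelyCompact _ (G.smul_mem ε⁻¹ hh)).exists_bound_of_continuousOn
    hgc.continuousOn
  refine ⟨max c 0, le_max_right _ _, fun x => ?_⟩
  change ‖g x - max (-max c 0) (min (g x) (max c 0))‖ₑ ≤ _
  set b := max c 0
  have hb : 0 ≤ b := le_max_right _ _
  by_cases hx : x ∈ sublevelAgainst χ (ε⁻¹ • h)
  · have hgb : |g x| ≤ b := (hc x (subset_closure hx)).trans (le_max_left _ _)
    rw [min_eq_left (abs_le.1 hgb).2, max_eq_right (abs_le.1 hgb).1]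
    simp
  · have hle' : |g x - max (-b) (min (g x) b)| ≤ h x := by
      refine le_trans ?_ (hle x)
      rcases le_total 0 (g x) with h0 | h0
      · rw [max_eq_right (by linarith [le_min h0 hb]), abs_of_nonneg h0,
          abs_of_nonneg (sub_nonneg.2 (min_le_left _ _))]
        linarith [le_min h0 hb]
      · rw [min_eq_left (h0.trans hb), abs_of_nonpos h0,
          abs_of_nonpos (sub_nonpos.2 (le_max_right _ _))]
        linarith [max_le (neg_nonpos.2 hb) h0]
    rw [Real.enorm_eq_ofReal_abs]
    calc ENNReal.ofReal |g x - max (-b) (min (g x) b)|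
        ≤ ENNReal.ofReal (ε * (ε⁻¹ • h) x) := by
          apply ENNReal.ofReal_le_ofReal
          rwa [Pi.smul_apply, smul_eq_mul, mul_inv_cancel_left₀ hε.ne']
      _ = ENNReal.ofReal ε * ENNReal.ofReal ((ε⁻¹ • h) x) := ENNReal.ofReal_mul hε.le
      _ ≤ _ := by gcongr; exact ofReal_le_of_notMem_sublevelAgainst hx

variable [MeasurableSpace X] [BorelSpace X]

lemma IsRegularityModulus.lintegral_enorm_le {μ : Measure X} {r : ℝ≥0}
    (hχ : IsRegularityModulus G χ) (hμ : ∫⁻ x, χ x ∂μ ≤ r) {ε : ℝ} {f : X → ℝ}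
    (hf : ∀ x, ‖f x‖ₑ ≤ ENNReal.ofReal ε * χ x) :
    ∫⁻ x, ‖f x‖ₑ ∂μ ≤ ENNReal.ofReal ε * r := by
  refine (lintegral_mono hf).trans ?_
  rw [lintegral_const_mul _ hχ.lowerSemicontinuous.measurable]
  gcongr

lemma IsRegularityModulus.integrable (hχ : IsRegularityModulus G χ)
    (hG : ConstantsAndMajorants G) {g : X → ℝ} (hg : g ∈ G) (hgc : Continuous g)
    {μ : Measure X} [IsFiniteMeasure μ] {r : ℝ≥0} (hμ : ∫⁻ x, χ x ∂μ ≤ r) :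
    Integrable g μ := by
  obtain ⟨c, hc, hle⟩ := hχ.exists_truncation hG hg hgc one_pos
  have hint := (boundedTruncation hgc c hc).integrable μ
  have hsub : Integrable (fun x => g x - boundedTruncation hgc c hc x) μ :=
    ⟨hgc.measurable.aestronglyMeasurable.sub hint.1,
      (hχ.lintegral_enorm_le hμ hle).trans_lt (by simp)⟩
  refine (hsub.add hint).congr (ae_of_all _ fun x => ?_)
  simp

/-- A uniform limit of integrals of bounded continuous truncations. -/
lemma IsRegularityModulus.continuousOn_integral (hχ : IsRegularityModulus G χ)
    (hG : ConstantsAndMajorants G) {g : X → ℝ} (hg : g ∈ G) (hgc : Continuous g) (r : ℝ≥0) :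
    ContinuousOn (fun μ : ProbabilityMeasure X => ∫ x, g x ∂(μ : Measure X))
      {μ | ∫⁻ x, χ x ∂(μ : Measure X) ≤ r} := by
  refine continuousOn_of_uniform_approx_of_continuousOn fun u hu => ?_
  obtain ⟨δ, hδ, hδu⟩ := Metric.mem_uniformity_dist.1 hu
  -- The error is at most `δr/(r + 1) < δ`, also when `r = 0`.
  have hε : 0 < δ / (r + 1) := by positivity
  obtain ⟨c, hc, hle⟩ := hχ.exists_truncation hG hg hgc hε
  refine ⟨fun μ => ∫ x, boundedTruncation hgc c hc x ∂(μ : Measure X), ?_, fun μ hμ => hδu ?_⟩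
  · refine Continuous.continuousOn (continuous_iff_continuousAt.2 fun μ => ?_)
    exact ProbabilityMeasure.tendsto_iff_forall_integral_tendsto.1 tendsto_id _
  · rw [dist_eq_norm, ← integral_sub (hχ.integrable hG hg hgc hμ)
      ((boundedTruncation hgc c hc).integrable _)]
    have h := (enorm_integral_le_lintegral_enorm _).trans (hχ.lintegral_enorm_le hμ hle)
    rw [← ofReal_norm, ← ENNReal.ofReal_coe_nnreal, ← ENNReal.ofReal_mul hε.le,
      ENNReal.ofReal_le_ofReal_iff (by positivity)] at h
    refine h.trans_lt ?_
    rw [div_mul_eq_mul_div, div_lt_iff₀ (by positivity)]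
    linarith [mul_add δ (r : ℝ) 1]

lemma IsRegularityModulus.isCompact_setOf_lintegral_le [PolishSpace X]
    (hχ : IsRegularityModulus G χ) (hG : ConstantsAndMajorants G) (r : ℝ≥0) :
    IsCompact {μ : ProbabilityMeasure X | ∫⁻ x, χ x ∂(μ : Measure X) ≤ r} := by
  rw [← (isClosed_setOf_lintegral_le hχ.lowerSemicontinuous r).closure_eq]
  apply isCompact_closure_of_isTightMeasureSet
  rw [isTightMeasureSet_iff_exists_isCompact_measure_compl_le]
  intro ε hε
  obtain ⟨n, hn0, hn⟩ : ∃ n : ℝ≥0, 0 < n ∧ (r : ℝ≥0∞) / n ≤ ε := by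
    rcases eq_or_ne ε ∞ with rfl | hεt
    · exact ⟨1, one_pos, le_top⟩
    · lift ε to ℝ≥0 using hεt
      have hε' : 0 < ε := by exact_mod_cast hε
      refine ⟨(r + 1) / ε, by positivity, ?_⟩
      rw [← ENNReal.coe_div (by positivity), ENNReal.coe_le_coe, div_div_eq_mul_div,
        div_le_iff₀ (by positivity), mul_comm]
      gcongr
      simp
  refine ⟨_, hχ.relativelyCompact _ (hG.const_mem n), ?_⟩
  rintro _ ⟨μ, hμ, rfl⟩
  calc (μ : Measure X) (closure (sublevelAgainst χ fun _ => (n : ℝ)))ᶜ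
      ≤ (μ : Measure X) {x | (n : ℝ≥0∞) ≤ χ x} := by
        refine measure_mono fun x hx => ?_
        simpa using ofReal_le_of_notMem_sublevelAgainst fun h => hx (subset_closure h)
    _ ≤ (∫⁻ x, χ x ∂(μ : Measure X)) / n :=
        meas_ge_le_lintegral_div hχ.lowerSemicontinuous.measurable.aemeasurable
          (by exact_mod_cast hn0.ne') ENNReal.coe_ne_top
    _ ≤ r / n := by gcongr; exact hμ
    _ ≤ ε := hn

/-- Integrability is automatic from the modulus bound, and the identity on `X` serves as the random
element. The bound is repeated inside the intersection because `∫ g` is only known to be continuous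
there. -/
lemma IsRegularityModulus.realisingFamily_eq (hχ : IsRegularityModulus G χ)
    (hG : ConstantsAndMajorants G) (hGcont : ∀ g ∈ G, Continuous g) (Φ : G →ₗ[ℝ] ℝ) (r : ℝ≥0) :
    realisingFamily Φ χ r = {μ : ProbabilityMeasure X | ∫⁻ x, χ x ∂(μ : Measure X) ≤ r} ∩
      ⋂ g : G, {μ : ProbabilityMeasure X | ∫⁻ x, χ x ∂(μ : Measure X) ≤ r} ∩
        (fun μ : ProbabilityMeasure X => ∫ x, (g : X → ℝ) x ∂(μ : Measure X)) ⁻¹' {Φ g} := by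
  ext μ
  simp only [mem_inter_iff, mem_iInter, mem_ofPred_eq, mem_preimage, mem_singleton_iff]
  constructor
  · rintro ⟨Ω, _, P, _, ξ, hξ, hmap⟩
    have hle : ∫⁻ x, χ x ∂(μ : Measure X) ≤ r := by
      rw [← hmap, lintegral_map hχ.lowerSemicontinuous.measurable hξ.measurable]
      exact hξ.expectation_modulus_le
    refine ⟨hle, fun g => ⟨hle, ?_⟩⟩
    rw [← hmap, integral_map hξ.measurable.aemeasurable
      (hGcont g g.2).measurable.aestronglyMeasurable]
    exact hξ.expectation_eq g
  · rintro ⟨hle, hμ⟩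
    refine ⟨X, _, μ, inferInstance, id, ⟨measurable_id, fun g => ?_, fun g => (hμ g).2, hle⟩,
      Measure.map_id⟩
    exact hχ.integrable hG g.2 (hGcont g g.2) hle

end RegularityModulus

/-- The topology on `ProbabilityMeasure X` is the topology of weak convergence. -/
theorem mainTheorem8 {X : Type*} [TopologicalSpace X] [PolishSpace X]
    [MeasurableSpace X] [BorelSpace X]
    (G : Submodule ℝ (X → ℝ)) (hG : ConstantsAndMajorants G)
    (hGcont : ∀ g ∈ G, Continuous g)
    (χ : X → ℝ≥0∞) (hχ : IsRegularityModulus G χ)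
    (Φ : G →ₗ[ℝ] ℝ) (hΦ : IsPositiveFunctional Φ) (r : ℝ≥0) :
    IsCompact (realisingFamily Φ χ r) := by
  rw [hχ.realisingFamily_eq hG hGcont]
  exact (hχ.isCompact_setOf_lintegral_le hG r).inter_right <| isClosed_iInter fun g =>
    (hχ.continuousOn_integral hG g.2 (hGcont g g.2) r).preimage_isClosed_of_isClosed
      (isClosed_setOf_lintegral_le hχ.lowerSemicontinuous r) isClosed_singleton
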